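/- Let $(R,\mathfrak m)$ be a Noetherian local ring and $I\subsetneq R$ a proper ideal; put $d=\dim R$ and $r=\dim R/I$. For $n\in\mathbb N$ let $I^{(n)}=\bigcap_{\mathfrak p\in\operatorname{Min}(I)}(I^nR_{\mathfrak p}\cap R)$ be the $n$-th symbolic power of $I$, where $\operatorname{Min}(I)$ is the set of minimal primes of $I$. Let $\mu(\cdot)$ denote the minimal number of generators, and define the symbolic analytic spread of $I$ by $$s\ell(I)=\inf\{t\in\mathbb R \mid \mu(I^{(n)})=O(n^{t-1})\text{ as } n\to\infty\}\in[-\infty,\infty].$$ 1. If $\operatorname{depth}R\ge r$ and $\operatorname{depth}R/I^{(n)}\ge r-1$ for all $n\gg0$, then $s\ell(I)\le d-r+1$; moreover $\mu(I^{(n)})=O(n^{d-r})$. 2. If $\operatorname{depth}R\ge r+1$ and $R/I^{(n)}$ is Cohen–Macaulay for all $n\gg0$, then $s\ell(I)\le d-r$; moreover $\mu(I^{(n)})=O(n^{d-r-1})$. -/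

import Mathlib

namespace SymbolicSpread

open Filter Asymptotics

/-- The `n`-th (ordinary) symbolic power `I^(n) = ⋂_{p ∈ Min(I)} (I^n R_p ∩ R)`, the intersection
running over the minimal primes of `I`. -/
noncomputable def symbolicPower {R : Type*} [CommRing R] (I : Ideal R) (n : ℕ) : Ideal R :=
  ⨅ p : {p : Ideal R // p ∈ I.minimalPrimes},
    haveI : (p : Ideal R).IsPrime := p.2.1.1
    ((I ^ n).map (algebraMap R (Localization.AtPrime (p : Ideal R)))).comap
      (algebraMap R (Localization.AtPrime (p : Ideal R)))

/-- The depth of a module `M` over a local ring `(R, 𝔪)`: the supremum of the lengths of the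
`M`-regular sequences contained in `𝔪`. If `M` is finitely generated and nonzero, the condition
`M ≠ (x₁, …, xₛ) M` in the definition of a regular sequence is automatic by Nakayama's lemma
(`IsLocalRing.isRegular_iff_isWeaklyRegular_of_subset_maximalIdeal`), so it is left out; thereby the
zero module gets depth `∞`. -/
noncomputable def depth (R : Type*) [CommRing R] [IsLocalRing R]
    (M : Type*) [AddCommGroup M] [Module R M] : ℕ∞ :=
  ⨆ rs : {rs : List R // (∀ x ∈ rs, x ∈ IsLocalRing.maximalIdeal R) ∧
    RingTheory.Sequence.IsWeaklyRegular M rs}, ((rs : List R).length : ℕ∞)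

/-- A (finitely generated) module over a Noetherian local ring is Cohen–Macaulay if it is zero or
its depth equals its dimension. -/
def IsCohenMacaulay (R : Type*) [CommRing R] [IsLocalRing R]
    (M : Type*) [AddCommGroup M] [Module R M] : Prop :=
  Subsingleton M ∨ (depth R M : WithBot ℕ∞) = Module.supportDim R M

/-- The set of real numbers `t` with `μ(I_n) = O(n ^ (t - 1))`, for a system of ideals `(I_n)`,
where `μ` is the minimal number of generators. -/
def growthExponents {R : Type*} [CommRing R] (𝓘 : ℕ → Ideal R) : Set ℝ :=
  {t : ℝ | (fun n : ℕ => ((𝓘 n).spanFinrank : ℝ)) =O[atTop] fun n : ℕ => (n : ℝ) ^ (t - 1)}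

/-- The analytic spread of a system of ideals: the infimum, in the extended reals, of the `t : ℝ`
with `μ(I_n) = O(n ^ (t - 1))`. It is `-∞` if `I_n = 0` for all large `n`. -/
noncomputable def analyticSpread {R : Type*} [CommRing R] (𝓘 : ℕ → Ideal R) : EReal :=
  sInf ((fun t : ℝ => (t : EReal)) '' growthExponents 𝓘)

/-- The symbolic analytic spread of an ideal. -/
noncomputable def symbolicAnalyticSpread {R : Type*} [CommRing R] (I : Ideal R) : EReal :=
  analyticSpread (symbolicPower I)

end SymbolicSpread

/-! By Nakayama, μ(J) is the length of J/𝔪J, the kernel of R/𝔪J → R/J. The heart is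
`length_ker_le_of_hasDepth`: if h : G → M is onto with kernel killed by x₁, …, x_s in 𝔪, a power of
𝔪 lies in (x) + Ann M, and depth M ≥ s - 1, then ℓ(ker h) ≤ ℓ(M/(x)M) + ℓ(G/(x)G). The depth allows
cutting by s - 1 elements regular on M without losing any of the kernel; for the one remaining
element x, the part of ker h inside xG is an image of (0 :_M x), whose length is at most ℓ(M/xM).

Choose x₁, …, x_s so that I + (x) is 𝔪-primary and dim R/(x) ≤ D = d - s. As J = I^(n) contains I^n,
a power 𝔪^N with N linear in n lies in J + (x). Both terms of the bound are then lengths of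
quotients of R/(x) killed by 𝔪^(N+1), hence O(n^D). Taking s = r gives part 1. A Cohen–Macaulay
R/I^(n) has depth at least r, which permits s = r + 1 and saves one power of n in part 2. -/

namespace SymbolicSpread

open Filter Asymptotics IsLocalRing RingTheory.Sequence
open scoped Pointwise

/-! ### Prime avoidance -/

section PrimeAvoidance

variable {R : Type*} [CommRing R]

/-- Prime avoidance for a coset `x + A` of an ideal. -/
theorem exists_add_notMem_of_finite (S : Finset (Ideal R)) (hS : ∀ p ∈ S, p.IsPrime)
    (x : R) (A : Ideal R) (h : ∀ p ∈ S, x ∈ p → ¬ A ≤ p) :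
    ∃ a ∈ A, ∀ p ∈ S, x + a ∉ p := by
  induction hn : S.card generalizing S with
  | zero =>
    rw [Finset.card_eq_zero] at hn
    exact ⟨0, A.zero_mem, by simp [hn]⟩
  | succ n ih =>
    classical
    have hne : S.Nonempty := Finset.card_pos.mp (by omega)
    -- With p minimal in S, no other member of S lies in p, so a correction b in A and in all the
    -- other primes can be found outside p.
    obtain ⟨p, hp⟩ := S.exists_minimal hne
    obtain ⟨a, haA, ha⟩ := ih (S.erase p) (fun q hq => hS q (Finset.mem_of_mem_erase hq))
      (fun q hq => h q (Finset.mem_of_mem_erase hq)) (by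
        rw [Finset.card_erase_of_mem hp.1]; omega)
    by_cases hxa : x + a ∈ p
    · have hprime := hS p hp.1
      have hAp : ¬ A ≤ p := fun hA =>
        h p hp.1 ((Ideal.add_mem_iff_left p (hA haA)).mp hxa) hA
      have hnot : ¬ A ⊓ (S.erase p).inf id ≤ p := by
        intro hle
        rcases (hprime.inf_le).mp hle with h1 | h1
        · exact hAp h1
        · obtain ⟨q, hq, hqp⟩ := (Ideal.IsPrime.inf_le' hprime).mp h1
          exact (Finset.ne_of_mem_erase hq)
            (le_antisymm hqp (hp.2 (Finset.mem_of_mem_erase hq) hqp))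
      obtain ⟨b, hb, hbp⟩ := SetLike.not_le_iff_exists.mp hnot
      refine ⟨a + b, A.add_mem haA hb.1, fun q hq hmem => ?_⟩
      rw [← add_assoc] at hmem
      by_cases hqp : q = p
      · subst hqp
        exact hbp ((Ideal.add_mem_iff_right q hxa).mp hmem)
      · have hqe := Finset.mem_erase.mpr ⟨hqp, hq⟩
        have hbq : b ∈ q := (Finset.inf_le hqe : (S.erase p).inf id ≤ q) hb.2
        exact ha q hqe ((Ideal.add_mem_iff_left q hbq).mp hmem)
    · refine ⟨a, haA, fun q hq => ?_⟩
      by_cases hqp : q = p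
      · rwa [hqp]
      · exact ha q (Finset.mem_erase.mpr ⟨hqp, hq⟩)

theorem isSMulRegular_of_forall_notMem [IsNoetherianRing R] {M : Type*} [AddCommGroup M] [Module R M] {w : R}
    (h : ∀ p ∈ associatedPrimes R M, w ∉ p) : IsSMulRegular M w := by
  by_contra hcon
  have : w ∈ ⋃ p ∈ associatedPrimes R M, (p : Set R) := by
    rw [biUnion_associatedPrimes_eq_compl_regular]; exact hcon
  simp only [Set.mem_iUnion] at this
  obtain ⟨p, hp, hw⟩ := this
  exact h p hp hw

end PrimeAvoidance

/-! ### Depth and regular elements -/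

section Depth

variable {R : Type*} [CommRing R] [IsLocalRing R]

/-- `M` admits a weakly regular sequence of length `k` in the maximal ideal. -/
def HasDepth (R : Type*) [CommRing R] [IsLocalRing R] (k : ℕ)
    (M : Type*) [AddCommGroup M] [Module R M] : Prop :=
  ∃ rs : List R, rs.length = k ∧ (∀ x ∈ rs, x ∈ maximalIdeal R) ∧ IsWeaklyRegular M rs

/-- The supremum may be infinite and not attained, so a sequence longer than k - 1 is found and
truncated. -/
theorem hasDepth_of_le_depth {k : ℕ} {M : Type*} [AddCommGroup M] [Module R M]
    (h : (k : ℕ∞) ≤ depth R M) : HasDepth R k M := by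
  rcases Nat.eq_zero_or_pos k with rfl | hk
  · exact ⟨[], rfl, by simp, by simp⟩
  have hlt : ((k - 1 : ℕ) : ℕ∞) < depth R M :=
    lt_of_lt_of_le (by exact_mod_cast Nat.sub_lt hk one_pos) h
  obtain ⟨⟨rs, hm, hr⟩, hlen⟩ := lt_iSup_iff.mp hlt
  have hlen' : k - 1 < rs.length := by exact_mod_cast hlen
  refine ⟨rs.take k, ?_, fun x hx => hm x (List.mem_of_mem_take hx), ?_⟩
  · rw [List.length_take]; omega
  · rw [← List.take_append_drop k rs] at hr
    exact ((isWeaklyRegular_append_iff _ _ _).mp hr).1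

theorem hasDepth_succ_iff {k : ℕ} {M : Type*} [AddCommGroup M] [Module R M] :
    HasDepth R (k + 1) M ↔
      ∃ x ∈ maximalIdeal R, IsSMulRegular M x ∧ HasDepth R k (QuotSMulTop x M) := by
  constructor
  · rintro ⟨rs, hlen, hm, hr⟩
    match rs, hlen with
    | x :: l, hlen =>
      rw [isWeaklyRegular_cons_iff] at hr
      exact ⟨x, hm x (by simp), hr.1, l, by simpa using hlen,
        fun y hy => hm y (by simp [hy]), hr.2⟩
  · rintro ⟨x, hx, hreg, l, hlen, hm, hl⟩
    refine ⟨x :: l, by simp [hlen], ?_, (isWeaklyRegular_cons_iff _ _ _).mpr ⟨hreg, hl⟩⟩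
    intro y hy
    rcases List.mem_cons.mp hy with rfl | hy
    · exact hx
    · exact hm y hy

theorem exists_isSMulRegular_of_associatedPrimes (S : Set (Ideal R)) (hS : S.Finite)
    (hp : ∀ p ∈ S, p.IsPrime) (hm : maximalIdeal R ∉ S) :
    ∃ w ∈ maximalIdeal R, ∀ p ∈ S, w ∉ p := by
  by_contra! hcon
  have hsub : ((maximalIdeal R : Ideal R) : Set R) ⊆ ⋃ p ∈ S, (p : Set R) := by
    intro w hw
    obtain ⟨p, hpS, hwp⟩ := hcon w hw
    exact Set.mem_biUnion hpS hwp
  obtain ⟨p, hpS, hle⟩ := (Ideal.subset_union_prime_finite hS (f := id) ⊤ ⊤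
    (fun p hpS _ _ => hp p hpS)).mp hsub
  have := (maximalIdeal.isMaximal R).eq_of_le (hp p hpS).ne_top hle
  exact hm (this ▸ hpS)

variable [IsNoetherianRing R]

theorem maximalIdeal_notMem_associatedPrimes {M : Type*} [AddCommGroup M] [Module R M]
    {w : R} (hw : w ∈ maximalIdeal R) (hreg : IsSMulRegular M w) :
    maximalIdeal R ∉ associatedPrimes R M := by
  intro h
  have : w ∈ ⋃ p ∈ associatedPrimes R M, (p : Set R) := Set.mem_biUnion h hw
  rw [biUnion_associatedPrimes_eq_compl_regular] at this
  exact this hreg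

/-- A socle argument. If 𝔪 = (zM : u), write x u = z v and w u = z t. Cancelling z gives w v = x t,
so v = x v' because w is regular on M/xM; cancelling x gives u = z v', hence 1 ∈ 𝔪. -/
theorem maximalIdeal_notMem_associatedPrimes_quotSMulTop {M : Type*} [AddCommGroup M]
    [Module R M] {x z : R} (hx : x ∈ maximalIdeal R)
    (hxM : IsSMulRegular M x) (hzM : IsSMulRegular M z)
    (h : ∃ w ∈ maximalIdeal R, IsSMulRegular (QuotSMulTop x M) w) :
    maximalIdeal R ∉ associatedPrimes R (QuotSMulTop z M) := by
  intro hass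
  obtain ⟨w, hw, hreg⟩ := h
  obtain ⟨-, u, hu⟩ := isAssociatedPrime_iff.mp (AssociatedPrimes.mem_iff.mp hass)
  obtain ⟨u, rfl⟩ := Submodule.mkQ_surjective _ u
  have key : ∀ a : R, a ∈ maximalIdeal R ↔ a • u ∈ z • (⊤ : Submodule R M) := by
    intro a
    rw [hu, Submodule.mem_colon_singleton, Submodule.mem_bot, ← map_smul, Submodule.mkQ_apply,
      Submodule.Quotient.mk_eq_zero]
  obtain ⟨v, -, hv⟩ := (Submodule.mem_smul_pointwise_iff_exists _ _ _).mp ((key x).mp hx)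
  obtain ⟨t, -, ht⟩ := (Submodule.mem_smul_pointwise_iff_exists _ _ _).mp ((key w).mp hw)
  have hwv : w • v = x • t := hzM (by
    change z • w • v = z • x • t
    rw [smul_comm z w, hv, smul_comm w x, ← ht, smul_comm x z])
  have hvx : v ∈ x • (⊤ : Submodule R M) :=
    mem_of_isSMulRegular_quotient_of_smul_mem hreg
      (hwv ▸ Submodule.smul_mem_pointwise_smul _ _ _ trivial)
  obtain ⟨v', -, rfl⟩ := (Submodule.mem_smul_pointwise_iff_exists _ _ _).mp hvx
  have huz : u = z • v' := hxM (by
    change x • u = x • z • v'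
    rw [← hv, smul_comm])
  have h1 : (1 : R) ∈ maximalIdeal R := (key 1).mpr (by
    rw [one_smul, huz]; exact Submodule.smul_mem_pointwise_smul _ _ _ trivial)
  exact (Ideal.ne_top_iff_one _).mp (maximalIdeal.isMaximal R).ne_top h1

theorem hasDepth_cons_swap {k : ℕ} {M : Type*} [AddCommGroup M] [Module R M]
    [Module.Finite R M] {x y : R} (hx : x ∈ maximalIdeal R) (hy : y ∈ maximalIdeal R)
    (hxM : IsSMulRegular M x) (hyM : IsSMulRegular (QuotSMulTop x M) y)
    (h : HasDepth R k (QuotSMulTop y (QuotSMulTop x M))) :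
    IsSMulRegular M y ∧ IsSMulRegular (QuotSMulTop y M) x ∧
      HasDepth R k (QuotSMulTop x (QuotSMulTop y M)) := by
  obtain ⟨l, hlen, hm, hl⟩ := h
  have hreg : IsWeaklyRegular M (x :: y :: l) := by
    simp only [isWeaklyRegular_cons_iff]; exact ⟨hxM, hyM, hl⟩
  have hmem : ∀ r ∈ x :: y :: l, r ∈ maximalIdeal R := by
    intro r hr
    simp only [List.mem_cons] at hr
    rcases hr with rfl | rfl | hr
    exacts [hx, hy, hm r hr]
  have := IsLocalRing.isWeaklyRegular_of_perm_of_subset_maximalIdeal hreg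
    (List.Perm.swap y x l) hmem
  simp only [isWeaklyRegular_cons_iff] at this
  exact ⟨this.1, this.2.1, l, hlen, hm, this.2.2⟩

/-- The depth drops by at most one modulo a regular element. -/
theorem HasDepth.quotSMulTop {k : ℕ} {M : Type*} [AddCommGroup M] [Module R M]
    [Module.Finite R M] {z : R} (hz : z ∈ maximalIdeal R) (hzM : IsSMulRegular M z)
    (h : HasDepth R (k + 1) M) : HasDepth R k (QuotSMulTop z M) := by
  induction k generalizing M z with
  | zero => exact ⟨[], rfl, by simp, by simp⟩
  | succ k ih =>
    obtain ⟨x, hx, hxM, hdx⟩ := hasDepth_succ_iff.mp h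
    obtain ⟨x', hx', hxM', -⟩ := hasDepth_succ_iff.mp hdx
    -- An element w regular on both M/xM and M/zM is the bridge: depth passes from M/xM to M/wM and
    -- then to M/zM by swapping (x, w) and (w, z), with the induction hypothesis applied to M/xM and
    -- M/wM.
    obtain ⟨w, hw, hwS⟩ := exists_isSMulRegular_of_associatedPrimes
      (associatedPrimes R (QuotSMulTop x M) ∪ associatedPrimes R (QuotSMulTop z M))
      ((associatedPrimes.finite R _).union (associatedPrimes.finite R _))
      (by rintro p (hp | hp) <;> exact hp.isPrime)
      (by
        rintro (hp | hp)
        · exact maximalIdeal_notMem_associatedPrimes hx' hxM' hp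
        · exact maximalIdeal_notMem_associatedPrimes_quotSMulTop hx hxM hzM ⟨x', hx', hxM'⟩ hp)
    have hwx : IsSMulRegular (QuotSMulTop x M) w :=
      isSMulRegular_of_forall_notMem fun p hp => hwS p (Or.inl hp)
    have hwz : IsSMulRegular (QuotSMulTop z M) w :=
      isSMulRegular_of_forall_notMem fun p hp => hwS p (Or.inr hp)
    obtain ⟨hwM, hxw, hd⟩ := hasDepth_cons_swap hx hw hxM hwx (ih hw hwx hdx)
    have hdw : HasDepth R (k + 1) (QuotSMulTop w M) := hasDepth_succ_iff.mpr ⟨x, hx, hxw, hd⟩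
    obtain ⟨-, hzw, -⟩ := hasDepth_cons_swap (k := 0) hz hw hzM hwz ⟨[], rfl, by simp, by simp⟩
    obtain ⟨-, -, hd'⟩ := hasDepth_cons_swap hw hz hwM hzw (ih hz hzw hdw)
    exact hasDepth_succ_iff.mpr ⟨w, hw, hwz, hd'⟩

end Depth

/-! ### Lengths of quotients by powers, and of kernels of multiplications -/

section Length

variable {R : Type*} [CommRing R]

theorem length_quotient_le_of_surjective {M N : Type*} [AddCommGroup M] [Module R M]
    [AddCommGroup N] [Module R N] {P : Submodule R M} (f : M →ₗ[R] N)
    (hf : Function.Surjective f) (h : P ≤ LinearMap.ker f) :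
    Module.length R N ≤ Module.length R (M ⧸ P) :=
  Module.length_le_of_surjective (P.liftQ f h) (by
    intro y
    obtain ⟨x, rfl⟩ := hf y
    exact ⟨P.mkQ x, by simp⟩)

/-- Filter by M ⊇ aM ⊇ abM: multiplication by a makes aM/abM a quotient of M/bM. -/
theorem length_quotSMulTop_mul_le {M : Type*} [AddCommGroup M] [Module R M] (a b : R) :
    Module.length R (QuotSMulTop (a * b) M) ≤
      Module.length R (QuotSMulTop a M) + Module.length R (QuotSMulTop b M) := by
  set π := (((a * b) • (⊤ : Submodule R M)).mkQ) with hπ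
  set N : Submodule R (QuotSMulTop (a * b) M) := LinearMap.range (π.comp (LinearMap.lsmul R M a))
  rw [Module.length_eq_add_of_exact N.subtype N.mkQ N.injective_subtype N.mkQ_surjective
    (LinearMap.exact_subtype_mkQ N), add_comm]
  refine add_le_add ?_ ?_
  · refine length_quotient_le_of_surjective (N.mkQ.comp π)
      (N.mkQ_surjective.comp (Submodule.mkQ_surjective _)) ?_
    intro m hm
    obtain ⟨v, -, rfl⟩ := (Submodule.mem_smul_pointwise_iff_exists _ _ _).mp hm
    rw [LinearMap.mem_ker, LinearMap.comp_apply, Submodule.mkQ_apply, Submodule.Quotient.mk_eq_zero]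
    exact ⟨v, rfl⟩
  · refine length_quotient_le_of_surjective (LinearMap.rangeRestrict _)
      (LinearMap.surjective_rangeRestrict _) ?_
    intro m hm
    obtain ⟨v, -, rfl⟩ := (Submodule.mem_smul_pointwise_iff_exists _ _ _).mp hm
    rw [LinearMap.ker_rangeRestrict, LinearMap.mem_ker, LinearMap.comp_apply, hπ,
      Submodule.mkQ_apply, Submodule.Quotient.mk_eq_zero, LinearMap.lsmul_apply, smul_smul]
    exact Submodule.smul_mem_pointwise_smul _ _ _ trivial

theorem length_quotSMulTop_pow_le {M : Type*} [AddCommGroup M] [Module R M] (a : R) (n : ℕ) :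
    Module.length R (QuotSMulTop (a ^ n) M) ≤ n * Module.length R (QuotSMulTop a M) := by
  induction n with
  | zero =>
    have : Subsingleton (QuotSMulTop (a ^ 0) M) := by
      rw [pow_zero, Submodule.Quotient.subsingleton_iff]
      exact one_smul _ _
    simp [Module.length_eq_zero]
  | succ n ih =>
    rw [pow_succ]
    refine (length_quotSMulTop_mul_le _ _).trans ?_
    push_cast
    rw [add_mul, one_mul]
    gcongr

/-- The elements are replaced by their powers one at a time, each at the cost of a factor n; no
regularity is needed. -/
theorem length_quotient_ofList_pow_le {M : Type*} [AddCommGroup M] [Module R M]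
    (ys : List R) (n : ℕ) :
    Module.length R (M ⧸ Ideal.ofList (ys.map (· ^ n)) • (⊤ : Submodule R M)) ≤
      n ^ ys.length * Module.length R (M ⧸ Ideal.ofList ys • (⊤ : Submodule R M)) := by
  induction ys generalizing M with
  | nil =>
    rw [List.length_nil, pow_zero, one_mul]
    exact le_rfl
  | cons y ys ih =>
    rw [List.map_cons,
      (Submodule.quotOfListConsSMulTopEquivQuotSMulTopInner M (y ^ n) (ys.map (· ^ n))).length_eq]
    refine ih.trans ?_
    rw [← (Submodule.quotOfListConsSMulTopEquivQuotSMulTopInner M (y ^ n) ys).length_eq,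
      (Submodule.quotOfListConsSMulTopEquivQuotSMulTopOuter M (y ^ n) ys).length_eq,
      (Submodule.quotOfListConsSMulTopEquivQuotSMulTopOuter M y ys).length_eq,
      List.length_cons, pow_succ, mul_assoc]
    gcongr
    exact length_quotSMulTop_pow_le y n

/-- The kernel of multiplication by `x` is at most as long as its cokernel. -/
theorem length_ker_lsmul_le {M : Type*} [AddCommGroup M] [Module R M] [IsNoetherian R M] (x : R) :
    Module.length R (LinearMap.ker (LinearMap.lsmul R M x)) ≤
      Module.length R (QuotSMulTop x M) := by
  by_cases htop : Module.length R (QuotSMulTop x M) = ⊤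
  · rw [htop]; exact le_top
  obtain ⟨k, hk⟩ := monotone_stabilizes_iff_noetherian.mpr ‹IsNoetherian R M›
    ⟨fun n => LinearMap.ker (LinearMap.lsmul R M (x ^ n)), monotone_nat_of_le_succ fun n v hv => by
      simp only [LinearMap.mem_ker, LinearMap.lsmul_apply] at hv ⊢
      rw [pow_succ', mul_smul, hv, smul_zero]⟩
  simp only [OrderHom.coe_mk] at hk
  -- N is the whole x-power torsion of M. It meets x^k M in 0, so it embeds in M/x^k M and has
  -- finite length.
  set N := LinearMap.ker (LinearMap.lsmul R M (x ^ k)) with hN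
  have memN : ∀ v, v ∈ N ↔ x ^ k • v = 0 := fun v => by simp [hN]
  have stable : ∀ j v, x ^ j • v = 0 → v ∈ N := by
    intro j v hv
    have h1 : v ∈ LinearMap.ker (LinearMap.lsmul R M (x ^ (k + j))) := by
      simp [pow_add, mul_smul, hv]
    rwa [← hk (k + j) (by omega)] at h1
  have hNfin : Module.length R N ≠ ⊤ := by
    have h1 : Module.length R N ≤ Module.length R (QuotSMulTop (x ^ k) M) := by
      refine Module.length_le_of_injective
        ((((x ^ k) • (⊤ : Submodule R M)).mkQ).comp N.subtype) ?_
      rw [← LinearMap.ker_eq_bot, LinearMap.ker_eq_bot']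
      rintro ⟨v, hv⟩ h0
      rw [LinearMap.comp_apply, Submodule.mkQ_apply, Submodule.Quotient.mk_eq_zero] at h0
      obtain ⟨u, -, hu⟩ := (Submodule.mem_smul_pointwise_iff_exists _ _ _).mp h0
      have hu' : x ^ k • u = v := hu
      have huN : u ∈ N := stable (k + k) u (by
        rw [pow_add, mul_smul, hu', (memN v).mp hv])
      ext
      change v = 0
      rw [← hu', (memN u).mp huN]
    refine ne_top_of_le_ne_top ?_ (h1.trans (length_quotSMulTop_pow_le x k))
    exact WithTop.mul_ne_top (WithTop.natCast_ne_top k) htop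
  set f : N →ₗ[R] N := LinearMap.lsmul R N x with hf
  have e1 := Module.length_eq_add_of_exact (LinearMap.ker f).subtype f.rangeRestrict
    (Submodule.injective_subtype _) f.surjective_rangeRestrict (by
      rw [LinearMap.exact_iff, LinearMap.ker_rangeRestrict, Submodule.range_subtype])
  have e2 := Module.length_eq_add_of_exact (LinearMap.range f).subtype (LinearMap.range f).mkQ
    (Submodule.injective_subtype _) (Submodule.mkQ_surjective _) (LinearMap.exact_subtype_mkQ _)
  have hrfin : Module.length R (LinearMap.range f) ≠ ⊤ :=
    ne_top_of_le_ne_top hNfin (Module.length_le_of_injective (LinearMap.range f).subtype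
      (Submodule.injective_subtype _))
  -- An endomorphism of a module of finite length has kernel and cokernel of equal length. It
  -- remains to see that ker x lies in N and that N/xN embeds in M/xM, since x u ∈ N forces u ∈ N.
  have e3 : Module.length R (LinearMap.ker f) = Module.length R (N ⧸ LinearMap.range f) := by
    rw [e1, add_comm] at e2
    exact ENat.add_right_injective_of_ne_top hrfin e2
  have h4 : Module.length R (LinearMap.ker (LinearMap.lsmul R M x)) ≤
      Module.length R (LinearMap.ker f) := by
    have hle : ∀ v ∈ LinearMap.ker (LinearMap.lsmul R M x), v ∈ N := fun v hv =>
      stable 1 v (by simpa using hv)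
    refine Module.length_le_of_injective
      (((Submodule.inclusion hle)).codRestrict (LinearMap.ker f) ?_) ?_
    · rintro ⟨v, hv⟩
      rw [LinearMap.mem_ker]
      ext
      exact hv
    · intro v w hvw
      ext
      exact congrArg (fun u => ((u : LinearMap.ker f) : N).1) hvw
  have h5 : Module.length R (N ⧸ LinearMap.range f) ≤ Module.length R (QuotSMulTop x M) := by
    refine Module.length_le_of_injective ((LinearMap.range f).mapQ (x • (⊤ : Submodule R M))
      N.subtype ?_) ?_
    · rintro _ ⟨v, rfl⟩
      exact Submodule.smul_mem_pointwise_smul (v : M) x ⊤ trivial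
    · rw [← LinearMap.ker_eq_bot, LinearMap.ker_eq_bot']
      intro v hv
      obtain ⟨v, rfl⟩ := Submodule.mkQ_surjective _ v
      rw [Submodule.mkQ_apply, Submodule.mapQ_apply, Submodule.Quotient.mk_eq_zero] at hv
      obtain ⟨u, -, hu⟩ := (Submodule.mem_smul_pointwise_iff_exists _ _ _).mp hv
      have hu' : x • u = (v : M) := hu
      rw [Submodule.mkQ_apply, Submodule.Quotient.mk_eq_zero]
      refine ⟨⟨u, stable (k + 1) u ?_⟩, Subtype.ext hu'⟩
      rw [pow_succ, mul_smul, hu']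
      exact (memN v).mp v.2
  exact h4.trans (e3.trans_le h5)

end Length

/-! ### Length of a kernel annihilated by a sequence -/

section KernelLength

variable {R : Type*} [CommRing R]

/-- Modulo xG, the kernel embeds in G/xG. The remaining part ker h ∩ xG is an image of (0 :_M x):
multiplication by x on G kills ker h, so it descends to a map M → G. -/
theorem length_ker_le_of_smul_ker_eq_zero {G M : Type*} [AddCommGroup G] [Module R G]
    [AddCommGroup M] [Module R M] [IsNoetherian R M] (h : G →ₗ[R] M)
    (hs : Function.Surjective h) (x : R) (hx : ∀ v ∈ LinearMap.ker h, x • v = 0) :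
    Module.length R (LinearMap.ker h) ≤
      Module.length R (QuotSMulTop x M) + Module.length R (QuotSMulTop x G) := by
  let ψ : LinearMap.ker h →ₗ[R] QuotSMulTop x G :=
    ((x • (⊤ : Submodule R G)).mkQ).comp (LinearMap.ker h).subtype
  rw [Module.length_eq_add_of_exact (LinearMap.ker ψ).subtype ψ.rangeRestrict
    (Submodule.injective_subtype _) ψ.surjective_rangeRestrict (by
      rw [LinearMap.exact_iff, LinearMap.ker_rangeRestrict, Submodule.range_subtype])]
  refine add_le_add ?_ (Module.length_le_of_injective (LinearMap.range ψ).subtype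
    (Submodule.injective_subtype _))
  refine le_trans ?_ (length_ker_lsmul_le x)
  let e := h.quotKerEquivOfSurjective hs
  let φ : M →ₗ[R] G := ((LinearMap.ker h).liftQ (LinearMap.lsmul R G x) (fun v hv => by
    simpa using hx v hv)).comp e.symm.toLinearMap
  have hφ : ∀ g, φ (h g) = x • g := by
    intro g
    have : e.symm (h g) = Submodule.Quotient.mk g := by
      rw [LinearEquiv.symm_apply_eq]; rfl
    simp [φ, this]
  have hmem : ∀ m : LinearMap.ker (LinearMap.lsmul R M x), φ m ∈ LinearMap.ker h := by
    rintro ⟨m, hm⟩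
    obtain ⟨g, rfl⟩ := hs m
    rw [LinearMap.mem_ker, hφ, map_smul]
    simpa using hm
  let θ : LinearMap.ker (LinearMap.lsmul R M x) →ₗ[R] LinearMap.ker h :=
    (φ.comp (Submodule.subtype _)).codRestrict _ hmem
  have hθ : ∀ m, θ m ∈ LinearMap.ker ψ := by
    rintro ⟨m, hm⟩
    obtain ⟨g, rfl⟩ := hs m
    change (x • (⊤ : Submodule R G)).mkQ (φ (h g)) = 0
    rw [hφ, Submodule.mkQ_apply, Submodule.Quotient.mk_eq_zero]
    exact Submodule.smul_mem_pointwise_smul _ _ _ trivial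
  refine Module.length_le_of_surjective (θ.codRestrict _ hθ) ?_
  rintro ⟨⟨v, hv⟩, hv'⟩
  have hv'' : v ∈ x • (⊤ : Submodule R G) := by
    rw [← Submodule.Quotient.mk_eq_zero]; exact hv'
  obtain ⟨u, -, rfl⟩ := (Submodule.mem_smul_pointwise_iff_exists _ _ _).mp hv''
  refine ⟨⟨h u, ?_⟩, ?_⟩
  · rw [LinearMap.mem_ker, LinearMap.lsmul_apply, ← map_smul]; exact hv
  · ext
    exact hφ u

theorem length_quotSMulTop_quotient_le {M : Type*} [AddCommGroup M] [Module R M]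
    (x a : R) (l : List R) (ha : a ∈ Ideal.ofList l) :
    Module.length R (QuotSMulTop (x + a) M ⧸
        Ideal.ofList l • (⊤ : Submodule R (QuotSMulTop (x + a) M))) ≤
      Module.length R (M ⧸ Ideal.ofList (x :: l) • (⊤ : Submodule R M)) := by
  rw [← (Submodule.quotOfListConsSMulTopEquivQuotSMulTopInner M (x + a) l).length_eq]
  have : Ideal.ofList ((x + a) :: l) = Ideal.ofList (x :: l) := by
    rw [Ideal.ofList_cons, Ideal.ofList_cons]
    apply le_antisymm
    · refine sup_le ?_ le_sup_right
      rw [Ideal.span_singleton_le_iff_mem]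
      exact add_mem (Ideal.mem_sup_left (Ideal.mem_span_singleton_self x))
        (Ideal.mem_sup_right ha)
    · refine sup_le ?_ le_sup_right
      rw [Ideal.span_singleton_le_iff_mem]
      have := sub_mem (Ideal.mem_sup_left (Ideal.mem_span_singleton_self (x + a)))
        (Ideal.mem_sup_right (S := Ideal.span {x + a}) ha)
      rwa [add_sub_cancel_right] at this
  rw [this]

variable [IsLocalRing R] [IsNoetherianRing R]

/-- Let `h : G → M` be surjective with kernel annihilated by a sequence `rs`. If `rs` is a system
of generators up to radical of the maximal ideal modulo `Ann M`, and `depth M ≥ rs.length - 1`, the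
length of `ker h` is bounded by the lengths of `M / (rs) M` and `G / (rs) G`. -/
theorem length_ker_le_of_hasDepth (rs : List R) {G M : Type*} [AddCommGroup G] [Module R G]
    [AddCommGroup M] [Module R M] [Module.Finite R M] (h : G →ₗ[R] M)
    (hs : Function.Surjective h) (hrs : ∀ x ∈ rs, x ∈ maximalIdeal R)
    (hker : ∀ x ∈ rs, ∀ v ∈ LinearMap.ker h, x • v = 0) {c : ℕ}
    (hc : maximalIdeal R ^ c ≤ Ideal.ofList rs ⊔ Module.annihilator R M)
    (hd : HasDepth R (rs.length - 1) M) :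
    Module.length R (LinearMap.ker h) ≤
      Module.length R (M ⧸ Ideal.ofList rs • (⊤ : Submodule R M)) +
        Module.length R (G ⧸ Ideal.ofList rs • (⊤ : Submodule R G)) := by
  match rs with
  | [] =>
    refine le_add_left ?_
    refine (Module.length_le_of_injective (LinearMap.ker h).subtype
      (Submodule.injective_subtype _)).trans ?_
    refine Module.length_le_of_injective (Ideal.ofList [] • (⊤ : Submodule R G)).mkQ ?_
    rw [← LinearMap.ker_eq_bot, Submodule.ker_mkQ, Ideal.ofList_nil, Submodule.bot_smul]
  | [x] =>
    rw [Ideal.ofList_singleton, Submodule.ideal_span_singleton_smul,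
      Submodule.ideal_span_singleton_smul]
    exact length_ker_le_of_smul_ker_eq_zero h hs x (hker x (by simp))
  | x :: y :: l =>
    obtain ⟨k, hk⟩ : ∃ k, (y :: l).length = k + 1 := ⟨l.length, rfl⟩
    have hd' : HasDepth R (k + 1) M := by
      have : (x :: y :: l).length - 1 = k + 1 := by simp at hk ⊢; omega
      rwa [this] at hd
    set tl := y :: l with htl
    have hxm : x ∈ maximalIdeal R := hrs x (by simp)
    have htm : Ideal.ofList tl ≤ maximalIdeal R :=
      Ideal.span_le.mpr fun r hr => hrs r (List.mem_cons_of_mem _ hr)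
    -- An associated prime containing x and (tl) also contains Ann M, so it would be 𝔪, which
    -- positive depth forbids. Thus x can be moved within x + (tl) to a regular element z, leaving
    -- the ideal (x, tl) unchanged.
    obtain ⟨a, ha, hza⟩ : ∃ a ∈ Ideal.ofList tl, ∀ p ∈ (associatedPrimes.finite R M).toFinset,
        x + a ∉ p := by
      refine exists_add_notMem_of_finite _ (fun p hp => ?_) x _ (fun p hp hxp hle => ?_)
      · exact ((Set.Finite.mem_toFinset _).mp hp).isPrime
      · have hass := (Set.Finite.mem_toFinset _).mp hp
        have hprime := hass.isPrime
        have hmp : maximalIdeal R ≤ p := by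
          refine hprime.le_of_pow_le (hc.trans (sup_le ?_
            (Submodule.annihilator_top (R := R) (M := M) ▸ hass.annihilator_le)))
          rw [Ideal.ofList_cons]
          exact sup_le ((Ideal.span_singleton_le_iff_mem _).mpr hxp) hle
        have heq := (maximalIdeal.isMaximal R).eq_of_le hprime.ne_top hmp
        obtain ⟨w, hw, hwM, -⟩ := hasDepth_succ_iff.mp hd'
        exact maximalIdeal_notMem_associatedPrimes hw hwM (heq ▸ hass)
    set z := x + a with hz
    have hzm : z ∈ maximalIdeal R := add_mem hxm (htm ha)
    have hzM : IsSMulRegular M z := isSMulRegular_of_forall_notMem fun p hp =>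
      hza p ((Set.Finite.mem_toFinset _).mpr hp)
    have htker : ∀ t ∈ Ideal.ofList tl, ∀ v ∈ LinearMap.ker h, t • v = 0 := by
      intro t ht v hv
      have : Ideal.ofList tl ≤ LinearMap.ker (LinearMap.toSpanSingleton R G v) :=
        Ideal.span_le.mpr fun r hr => by
          simpa using hker r (List.mem_cons_of_mem _ hr) v hv
      simpa using this ht
    have hzker : ∀ v ∈ LinearMap.ker h, z • v = 0 := by
      intro v hv
      rw [hz, add_smul, hker x (by simp) v hv, htker a ha v hv, add_zero]
    let h' := QuotSMulTop.map z h
    have hs' : Function.Surjective h' := by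
      intro m
      obtain ⟨m, rfl⟩ := Submodule.mkQ_surjective _ m
      obtain ⟨g, rfl⟩ := hs m
      exact ⟨Submodule.Quotient.mk g, rfl⟩
    have hmap : ∀ u : G, (Submodule.Quotient.mk u : QuotSMulTop z G) ∈ LinearMap.ker h' →
        ∃ w, h u = z • h w := by
      intro u hu
      have h0 : (Submodule.Quotient.mk (h u) : QuotSMulTop z M) = 0 := hu
      rw [Submodule.Quotient.mk_eq_zero] at h0
      obtain ⟨m, -, hm⟩ := (Submodule.mem_smul_pointwise_iff_exists _ _ _).mp h0
      obtain ⟨w, rfl⟩ := hs m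
      exact ⟨w, hm.symm⟩
    -- If h u = z h w, then u - z w lies in ker h and is killed by t, so t u = z t w vanishes modulo
    -- z.
    have hker' : ∀ t ∈ tl, ∀ v ∈ LinearMap.ker h', t • v = 0 := by
      intro t ht v hv
      obtain ⟨u, rfl⟩ := Submodule.mkQ_surjective _ v
      obtain ⟨w, hw⟩ := hmap u hv
      have h1 : t • (u - z • w) = 0 := hker t (List.mem_cons_of_mem _ ht) _ (by
        rw [LinearMap.mem_ker, map_sub, map_smul, hw, sub_self])
      rw [smul_sub, sub_eq_zero] at h1
      rw [← map_smul, h1, smul_comm, Submodule.mkQ_apply, Submodule.Quotient.mk_eq_zero]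
      exact Submodule.smul_mem_pointwise_smul _ _ _ trivial
    have hc' : maximalIdeal R ^ c ≤
        Ideal.ofList tl ⊔ Module.annihilator R (QuotSMulTop z M) := by
      refine hc.trans (sup_le ?_ ?_)
      · rw [Ideal.ofList_cons]
        refine sup_le ((Ideal.span_singleton_le_iff_mem _).mpr ?_) le_sup_left
        have : x = z - a := by rw [hz]; ring
        rw [this]
        exact sub_mem (Ideal.mem_sup_right (QuotSMulTop.mem_annihilator M z))
          (Ideal.mem_sup_left ha)
      · exact le_sup_of_le_right
          (LinearMap.annihilator_le_of_surjective _ (Submodule.mkQ_surjective _))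
    have key := length_ker_le_of_hasDepth tl h' hs' (fun t ht => hrs t (List.mem_cons_of_mem _ ht))
      hker' hc' (by rw [hk]; exact hd'.quotSMulTop hzm hzM)
    refine le_trans ?_ (key.trans (add_le_add (length_quotSMulTop_quotient_le x a tl ha)
      (length_quotSMulTop_quotient_le x a tl ha)))
    have hmem : ∀ v : LinearMap.ker h,
        (Submodule.mkQ (z • (⊤ : Submodule R G))) v ∈ LinearMap.ker h' := by
      rintro ⟨v, hv⟩
      change (Submodule.Quotient.mk (h v) : QuotSMulTop z M) = 0
      rw [LinearMap.mem_ker.mp hv, Submodule.Quotient.mk_zero]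
    -- The kernel survives reduction modulo z: if z w ∈ ker h, then h w = 0 by regularity of z on M,
    -- so w ∈ ker h and z w = 0.
    refine Module.length_le_of_injective (((Submodule.mkQ (z • (⊤ : Submodule R G))).comp
      (LinearMap.ker h).subtype).codRestrict _ hmem) ?_
    rw [← LinearMap.ker_eq_bot, LinearMap.ker_eq_bot']
    rintro ⟨v, hv⟩ h0
    have h1 : (Submodule.Quotient.mk v : QuotSMulTop z G) = 0 := congrArg Subtype.val h0
    rw [Submodule.Quotient.mk_eq_zero] at h1
    obtain ⟨w, -, rfl⟩ := (Submodule.mem_smul_pointwise_iff_exists _ _ _).mp h1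
    have hzw : z • h w = 0 := by rw [← map_smul]; exact hv
    have hw : h w = 0 := hzM.right_eq_zero_of_smul hzw
    ext
    exact hzker w hw
termination_by rs.length
decreasing_by simp

end KernelLength

/-! ### Systems of parameters and finite length -/

section Parameters

variable {R : Type*} [CommRing R]

theorem ringKrullDim_quotient_mono {I J : Ideal R} (h : I ≤ J) :
    ringKrullDim (R ⧸ J) ≤ ringKrullDim (R ⧸ I) :=
  ringKrullDim_le_of_surjective (Ideal.Quotient.factor h) (Ideal.Quotient.factor_surjective h)

theorem ringKrullDim_quotient_sup_span_succ_le {I : Ideal R} {x : R}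
    (hx : ∀ p ∈ I.minimalPrimes, x ∉ p) :
    ringKrullDim (R ⧸ I ⊔ Ideal.span {x}) + 1 ≤ ringKrullDim (R ⧸ I) := by
  have h := Module.supportDim_quotSMulTop_succ_le_of_notMem_minimalPrimes (R := R) (M := R ⧸ I)
    (x := x) (by rwa [Ideal.annihilator_quotient])
  rw [Module.supportDim_quotient_eq_ringKrullDim] at h
  refine le_trans (le_of_eq ?_) h
  rw [ringKrullDim_quotient, Module.supportDim, Module.support_quotSMulTop,
    Module.support_eq_zeroLocus, Ideal.annihilator_quotient, PrimeSpectrum.zeroLocus_sup,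
    PrimeSpectrum.zeroLocus_span]

variable [IsLocalRing R]

theorem maximalIdeal_le_radical_of_ringKrullDim_le_zero {I : Ideal R}
    (h : ringKrullDim (R ⧸ I) ≤ 0) : maximalIdeal R ≤ I.radical := by
  rw [Ideal.radical_eq_sInf]
  refine le_sInf ?_
  rintro p ⟨hIp, hp⟩
  have : Ring.KrullDimLE 0 (R ⧸ p) :=
    Ring.krullDimLE_iff.mpr (by simpa using (ringKrullDim_quotient_mono hIp).trans h)
  have hmax : p.IsMaximal := by
    have hb : (⊥ : Ideal (R ⧸ p)).IsMaximal := Ideal.IsPrime.isMaximal' inferInstance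
    exact Ideal.Quotient.maximal_of_isField _
      (Ring.isField_iff_maximal_bot.mpr hb)
  exact (IsLocalRing.eq_maximalIdeal hmax).ge

theorem krullDimLE_zero_quotient {I : Ideal R}
    (h : ∀ p : Ideal R, p.IsPrime → I ≤ p → maximalIdeal R ≤ p) :
    Ring.KrullDimLE 0 (R ⧸ I) := by
  rw [Ring.krullDimLE_zero_iff]
  intro p hp
  have hIp : I ≤ p.comap (Ideal.Quotient.mk I) := by
    intro x hx
    rw [Ideal.mem_comap, Ideal.Quotient.eq_zero_iff_mem.mpr hx]
    exact p.zero_mem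
  have hprime : (p.comap (Ideal.Quotient.mk I)).IsPrime := Ideal.IsPrime.comap _
  have hmax : (p.comap (Ideal.Quotient.mk I)).IsMaximal :=
    (maximalIdeal.isMaximal R).eq_of_le hprime.ne_top (h _ hprime hIp) ▸
      maximalIdeal.isMaximal R
  have hmap := Ideal.map_comap_of_surjective (Ideal.Quotient.mk I) Ideal.Quotient.mk_surjective p
  rcases Ideal.map_eq_top_or_isMaximal_of_surjective (Ideal.Quotient.mk I)
    Ideal.Quotient.mk_surjective hmax with h1 | h1
  · exact absurd (hmap ▸ h1) hp.ne_top
  · rwa [hmap] at h1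

theorem ringKrullDim_quotient_le_zero_of_mem_minimalPrimes {I : Ideal R}
    (h : maximalIdeal R ∈ I.minimalPrimes) : ringKrullDim (R ⧸ I) ≤ 0 := by
  have : Ring.KrullDimLE 0 (R ⧸ I) := krullDimLE_zero_quotient fun p hp hIp =>
    h.2 ⟨hp, hIp⟩ (IsLocalRing.le_maximalIdeal hp.ne_top)
  simpa using Ring.krullDimLE_iff.mp this

theorem ofList_map_pow_le {ys : List R} (hys : ∀ y ∈ ys, y ∈ maximalIdeal R) (N : ℕ) :
    Ideal.ofList (ys.map (· ^ N)) ≤ maximalIdeal R ^ N := by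
  refine Ideal.span_le.mpr fun r hr => ?_
  obtain ⟨y, hy, rfl⟩ := List.mem_map.mp hr
  exact Ideal.pow_mem_pow (hys y hy) N

/-- An x in 𝔪 cannot avoid 𝔪, but if 𝔪 is minimal over I then dim R/I ≤ 0 already. -/
theorem ringKrullDim_quotient_sup_span_le {I : Ideal R} {x : R} {n : ℕ}
    (hx : ∀ p ∈ I.minimalPrimes, p ≠ maximalIdeal R → x ∉ p)
    (hI : ringKrullDim (R ⧸ I) ≤ (n + 1 : ℕ)) :
    ringKrullDim (R ⧸ I ⊔ Ideal.span {x}) ≤ n := by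
  by_cases hm : maximalIdeal R ∈ I.minimalPrimes
  · refine (ringKrullDim_quotient_mono le_sup_left).trans
      ((ringKrullDim_quotient_le_zero_of_mem_minimalPrimes hm).trans ?_)
    exact_mod_cast Nat.zero_le n
  · have h := (ringKrullDim_quotient_sup_span_succ_le (I := I) (x := x)
      fun p hp => hx p hp (fun h => hm (h ▸ hp))).trans hI
    generalize ringKrullDim (R ⧸ I ⊔ Ideal.span {x}) = e at h ⊢
    induction e using WithBot.recBotCoe with
    | bot => exact bot_le
    | coe a =>
      have h' : a + 1 ≤ (n : ℕ∞) + 1 := by exact_mod_cast h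
      exact_mod_cast (ENat.add_le_add_iff_right ENat.one_ne_top).mp h'

/-- Since y^N ∈ 𝔪^N, P is a quotient of R/(xs, y^N : y ∈ ys). This is the source of the polynomial
growth. -/
theorem length_le_pow_mul_length (xs ys : List R) (hys : ∀ y ∈ ys, y ∈ maximalIdeal R)
    {P : Type*} [AddCommGroup P] [Module R P] (f : R →ₗ[R] P) (hf : Function.Surjective f)
    (hxs : Ideal.ofList xs ≤ LinearMap.ker f) {N : ℕ}
    (hN : maximalIdeal R ^ N ≤ LinearMap.ker f) :
    Module.length R P ≤ N ^ ys.length *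
      Module.length R ((R ⧸ Ideal.ofList xs) ⧸
        Ideal.ofList ys • (⊤ : Submodule R (R ⧸ Ideal.ofList xs))) := by
  refine le_trans ?_ (length_quotient_ofList_pow_le ys N)
  refine length_quotient_le_of_surjective ((Ideal.ofList xs).liftQ f hxs) ?_ ?_
  · intro y
    obtain ⟨x, rfl⟩ := hf y
    exact ⟨Submodule.Quotient.mk x, rfl⟩
  · refine Submodule.smul_le.mpr fun r hr n _ => ?_
    obtain ⟨a, rfl⟩ := Submodule.mkQ_surjective _ n
    have h0 : f r = 0 := hN (ofList_map_pow_le hys N hr)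
    rw [LinearMap.mem_ker, map_smul, Submodule.mkQ_apply, Submodule.liftQ_apply, ← map_smul,
      smul_eq_mul, mul_comm, ← smul_eq_mul, map_smul, h0, smul_zero]

variable [IsNoetherianRing R]

/-- Simultaneous choice of partial systems of parameters for two quotients of `R`. -/
theorem exists_list_ringKrullDim_le (s : ℕ) (I J : Ideal R) (D : ℕ)
    (hI : ringKrullDim (R ⧸ I) ≤ s) (hJ : ringKrullDim (R ⧸ J) ≤ (s + D : ℕ)) :
    ∃ xs : List R, xs.length = s ∧ (∀ x ∈ xs, x ∈ maximalIdeal R) ∧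
      maximalIdeal R ≤ (I ⊔ Ideal.ofList xs).radical ∧
      ringKrullDim (R ⧸ J ⊔ Ideal.ofList xs) ≤ D := by
  induction s generalizing I J with
  | zero =>
    refine ⟨[], rfl, by simp, ?_, ?_⟩
    · rw [Ideal.ofList_nil, sup_bot_eq]
      exact maximalIdeal_le_radical_of_ringKrullDim_le_zero (by simpa using hI)
    · rw [Ideal.ofList_nil, sup_bot_eq]
      simpa using hJ
  | succ s ih =>
    obtain ⟨x, hx, hxS⟩ := exists_isSMulRegular_of_associatedPrimes
      ((I.minimalPrimes ∪ J.minimalPrimes) \ {maximalIdeal R})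
      (((I.finite_minimalPrimes_of_isNoetherianRing R).union
        (J.finite_minimalPrimes_of_isNoetherianRing R)).subset Set.sdiff_subset)
      (by rintro p ⟨hp | hp, -⟩ <;> exact hp.1.1) (by simp)
    obtain ⟨xs, hlen, hm, h1, h2⟩ := ih (I ⊔ Ideal.span {x}) (J ⊔ Ideal.span {x})
      (ringKrullDim_quotient_sup_span_le (fun p hp hne => hxS p ⟨Or.inl hp, hne⟩) hI)
      (ringKrullDim_quotient_sup_span_le (fun p hp hne => hxS p ⟨Or.inr hp, hne⟩)
        (by convert hJ using 2; omega))
    refine ⟨x :: xs, by simp [hlen], ?_, ?_, ?_⟩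
    · intro y hy
      rcases List.mem_cons.mp hy with rfl | hy
      exacts [hx, hm y hy]
    · rwa [Ideal.ofList_cons, ← sup_assoc]
    · rwa [Ideal.ofList_cons, ← sup_assoc]

theorem exists_pow_maximalIdeal_le {I : Ideal R} (h : maximalIdeal R ≤ I.radical) :
    ∃ c, maximalIdeal R ^ c ≤ I :=
  Ideal.exists_pow_le_of_le_radical_of_fg h (IsNoetherian.noetherian _)

theorem length_quotient_ne_top_of_pow_le {I : Ideal R} {c : ℕ} (h : maximalIdeal R ^ c ≤ I) :
    Module.length R (R ⧸ I) ≠ ⊤ := by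
  have : Ring.KrullDimLE 0 (R ⧸ I) := krullDimLE_zero_quotient fun p hp hIp =>
    hp.le_of_pow_le (h.trans hIp)
  have : IsArtinianRing (R ⧸ I) := IsNoetherianRing.isArtinianRing_of_krullDimLE_zero
  rw [Module.length_eq_of_surjective (S := R) (R := R ⧸ I) (M := R ⧸ I)
    Ideal.Quotient.mk_surjective]
  exact Module.length_ne_top

end Parameters

/-! ### Growth of the number of generators -/

section Growth

variable {R : Type*} [CommRing R]

theorem mem_growthExponents_of_isBigO {𝓘 : ℕ → Ideal R} {D : ℕ} {t : ℝ} (ht : t = D + 1)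
    (h : (fun n : ℕ => ((𝓘 n).spanFinrank : ℝ)) =O[atTop] fun n : ℕ => (n : ℝ) ^ D) :
    analyticSpread 𝓘 ≤ (t : EReal) ∧ t ∈ growthExponents 𝓘 := by
  have hmem : t ∈ growthExponents 𝓘 := by
    simpa [growthExponents, ht] using h
  exact ⟨sInf_le ⟨t, hmem, rfl⟩, hmem⟩

variable [IsLocalRing R] [IsNoetherianRing R]

/-- By Nakayama, μ(J) is the length of J/𝔪J, which embeds in this kernel. -/
theorem spanFinrank_le_length_ker (J : Ideal R) :
    (J.spanFinrank : ℕ∞) ≤ Module.length R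
      (LinearMap.ker (Submodule.factor (Ideal.mul_le_right : maximalIdeal R * J ≤ J))) := by
  have hfin : Module.Finite (R ⧸ maximalIdeal R)
      (J ⧸ maximalIdeal R • (⊤ : Submodule R J)) := Module.Finite.of_restrictScalars_finite R _ _
  rw [IsLocalRing.spanFinrank_eq_finrank_quotient J (IsNoetherian.noetherian J)]
  let _ : Field (R ⧸ maximalIdeal R) := Ideal.Quotient.field _
  rw [← Module.length_eq_finrank (R ⧸ maximalIdeal R)
      (J ⧸ maximalIdeal R • (⊤ : Submodule R J)),
    ← Module.length_eq_of_surjective (S := R) (R := R ⧸ maximalIdeal R) Ideal.Quotient.mk_surjective]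
  set π := Submodule.mkQ (maximalIdeal R * J)
  have hmem : ∀ v : J, (π.comp (Submodule.subtype J)) v ∈ LinearMap.ker
      (Submodule.factor (Ideal.mul_le_right : maximalIdeal R * J ≤ J)) := by
    rintro ⟨v, hv⟩
    change (Submodule.Quotient.mk v : R ⧸ J) = 0
    rwa [Submodule.Quotient.mk_eq_zero]
  have hkey : ∀ v : J, π v = 0 → v ∈ maximalIdeal R • (⊤ : Submodule R J) := by
    intro v hv
    rw [Submodule.mkQ_apply, Submodule.Quotient.mk_eq_zero, ← smul_eq_mul] at hv
    have hmap : maximalIdeal R • J =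
        (maximalIdeal R • (⊤ : Submodule R J)).map (Submodule.subtype J) := by
      rw [Submodule.map_smul'', Submodule.map_top, Submodule.range_subtype]
    rw [hmap] at hv
    obtain ⟨w, hw, hwv⟩ := hv
    rwa [← Subtype.ext hwv]
  refine Module.length_le_of_injective ((maximalIdeal R • (⊤ : Submodule R J)).liftQ
    ((π.comp (Submodule.subtype J)).codRestrict _ hmem) ?_) ?_
  · refine Submodule.smul_le.mpr fun r hr n _ => ?_
    rw [LinearMap.mem_ker]
    ext
    change π (r • (n : R)) = 0
    rw [Submodule.mkQ_apply, Submodule.Quotient.mk_eq_zero]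
    exact Ideal.mul_mem_mul hr n.2
  · rw [← LinearMap.ker_eq_bot, LinearMap.ker_eq_bot']
    intro v hv
    obtain ⟨v, rfl⟩ := Submodule.mkQ_surjective _ v
    rw [Submodule.mkQ_apply, Submodule.Quotient.mk_eq_zero]
    exact hkey v (congrArg Subtype.val hv)

/-- A uniform bound for the number of generators of an ideal `J` with `depth R/J ≥ s - 1`, where
`s` elements `xs` are given such that `𝔪 ^ N ⊆ J + (xs)`. -/
theorem spanFinrank_le_of_hasDepth (J : Ideal R) (xs ys : List R)
    (hxs : ∀ x ∈ xs, x ∈ maximalIdeal R) (hys : ∀ y ∈ ys, y ∈ maximalIdeal R) {N : ℕ}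
    (hN : maximalIdeal R ^ N ≤ J ⊔ Ideal.ofList xs) (hd : HasDepth R (xs.length - 1) (R ⧸ J)) :
    (J.spanFinrank : ℕ∞) ≤ 2 * ((N + 1 : ℕ) ^ ys.length *
      Module.length R ((R ⧸ Ideal.ofList xs) ⧸
        Ideal.ofList ys • (⊤ : Submodule R (R ⧸ Ideal.ofList xs)))) := by
  have hxm : Ideal.ofList xs ≤ maximalIdeal R := Ideal.span_le.mpr hxs
  set K := maximalIdeal R * J
  have hKJ : K ≤ J := Ideal.mul_le_right
  -- Passing from J to 𝔪J costs one more power of 𝔪.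
  have hN' : maximalIdeal R ^ (N + 1) ≤ K ⊔ Ideal.ofList xs := by
    rw [pow_succ']
    refine (Ideal.mul_mono_right hN).trans ?_
    rw [Ideal.mul_sup]
    exact sup_le_sup le_rfl Ideal.mul_le_right
  have bound : ∀ L : Ideal R, maximalIdeal R ^ (N + 1) ≤ L ⊔ Ideal.ofList xs →
      Module.length R ((R ⧸ L) ⧸ Ideal.ofList xs • (⊤ : Submodule R (R ⧸ L))) ≤
      (N + 1 : ℕ) ^ ys.length * Module.length R ((R ⧸ Ideal.ofList xs) ⧸
        Ideal.ofList ys • (⊤ : Submodule R (R ⧸ Ideal.ofList xs))) := by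
    intro L hL
    let f : R →ₗ[R] ((R ⧸ L) ⧸ Ideal.ofList xs • (⊤ : Submodule R (R ⧸ L))) :=
      (Submodule.mkQ _).comp (Submodule.mkQ L)
    have hfx : Ideal.ofList xs ≤ LinearMap.ker f := by
      intro x hx
      rw [LinearMap.mem_ker, LinearMap.comp_apply, Submodule.mkQ_apply (Ideal.ofList xs • _),
        Submodule.Quotient.mk_eq_zero]
      have : (Submodule.mkQ L) x = x • (Submodule.mkQ L) 1 := by rw [← map_smul]; simp
      rw [this]
      exact Submodule.smul_mem_smul hx trivial
    have hfL : L ≤ LinearMap.ker f := by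
      intro x hx
      rw [LinearMap.mem_ker, LinearMap.comp_apply, Submodule.mkQ_apply L,
        (Submodule.Quotient.mk_eq_zero L).mpr hx, map_zero]
    exact length_le_pow_mul_length xs ys hys f
      ((Submodule.mkQ_surjective _).comp (Submodule.mkQ_surjective _)) hfx
      (hL.trans (sup_le hfL hfx))
  refine (spanFinrank_le_length_ker J).trans ((length_ker_le_of_hasDepth xs
    (Submodule.factor hKJ) (Submodule.factor_surjective hKJ) hxs ?_ (c := N) ?_ hd).trans ?_)
  · intro x hx v hv
    obtain ⟨a, rfl⟩ := Submodule.mkQ_surjective _ v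
    have ha : (Submodule.Quotient.mk a : R ⧸ J) = 0 := hv
    rw [Submodule.Quotient.mk_eq_zero] at ha
    rw [← map_smul, Submodule.mkQ_apply, Submodule.Quotient.mk_eq_zero]
    exact Ideal.mul_mem_mul (hxs x hx) ha
  · rw [Ideal.annihilator_quotient, sup_comm]; exact hN
  · rw [two_mul]
    exact add_le_add (bound J (hN'.trans (sup_le_sup hKJ le_rfl))) (bound K hN')

theorem isBigO_spanFinrank (I : Ideal R) (𝓘 : ℕ → Ideal R) (h𝓘 : ∀ n, I ^ n ≤ 𝓘 n) (s D : ℕ)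
    (hI : ringKrullDim (R ⧸ I) ≤ s) (hR : ringKrullDim R ≤ (s + D : ℕ))
    (hd : ∀ᶠ n in atTop, HasDepth R (s - 1) (R ⧸ 𝓘 n)) :
    (fun n : ℕ => ((𝓘 n).spanFinrank : ℝ)) =O[atTop] fun n : ℕ => (n : ℝ) ^ D := by
  obtain ⟨xs, hlen, hxs, hIx, hxD⟩ := exists_list_ringKrullDim_le s I ⊥ D hI (by
    rwa [ringKrullDim_eq_of_ringEquiv (RingEquiv.quotientBot R)])
  rw [bot_sup_eq] at hxD
  -- Only one ideal matters here; the second one is a dummy.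
  obtain ⟨ys, hylen, hys, hxy, -⟩ := exists_list_ringKrullDim_le D (Ideal.ofList xs)
    (Ideal.ofList xs) 0 hxD (by simpa using hxD)
  obtain ⟨c, hc⟩ := exists_pow_maximalIdeal_le hIx
  obtain ⟨e, he⟩ := exists_pow_maximalIdeal_le hxy
  set Λ := Module.length R ((R ⧸ Ideal.ofList xs) ⧸
    Ideal.ofList ys • (⊤ : Submodule R (R ⧸ Ideal.ofList xs))) with hΛ
  have hΛtop : Λ ≠ ⊤ := by
    refine ne_top_of_le_ne_top (length_quotient_ne_top_of_pow_le he)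
      (length_quotient_le_of_surjective ((Submodule.mkQ _).comp (Submodule.mkQ _))
        ((Submodule.mkQ_surjective _).comp (Submodule.mkQ_surjective _)) (sup_le ?_ ?_))
    · intro x hx
      rw [LinearMap.mem_ker, LinearMap.comp_apply, Submodule.mkQ_apply (Ideal.ofList xs),
        (Submodule.Quotient.mk_eq_zero _).mpr hx, map_zero]
    · intro y hy
      rw [LinearMap.mem_ker, LinearMap.comp_apply, Submodule.mkQ_apply (Ideal.ofList ys • _),
        Submodule.Quotient.mk_eq_zero]
      have : (Submodule.mkQ (Ideal.ofList xs)) y = y • (Submodule.mkQ (Ideal.ofList xs)) 1 := by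
        rw [← map_smul]; simp
      rw [this]
      exact Submodule.smul_mem_smul hy trivial
  obtain ⟨l, hl⟩ := ENat.ne_top_iff_exists.mp hΛtop
  refine IsBigO.of_bound ((2 * (2 * c + 1) ^ D * l : ℕ) : ℝ) ?_
  filter_upwards [hd, eventually_ge_atTop 1] with n hn hn1
  -- The exponent n + 1 comes from (I + (xs))^(n+1) ⊆ I^n + (xs).
  have hpow : maximalIdeal R ^ (c * (n + 1)) ≤ 𝓘 n ⊔ Ideal.ofList xs := by
    rw [pow_mul]
    refine (Ideal.pow_right_mono hc (n + 1)).trans (Ideal.sup_pow_add_le_pow_sup_pow.trans ?_)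
    rw [pow_one]
    exact sup_le_sup (h𝓘 n) le_rfl
  have h1 := spanFinrank_le_of_hasDepth (𝓘 n) xs ys hxs hys hpow (by rwa [hlen])
  rw [← hΛ, ← hl, hylen] at h1
  have h2 : (𝓘 n).spanFinrank ≤ 2 * ((c * (n + 1) + 1) ^ D * l) := by exact_mod_cast h1
  have h3 : 2 * ((c * (n + 1) + 1) ^ D * l) ≤ (2 * (2 * c + 1) ^ D * l) * n ^ D := by
    have : c * (n + 1) + 1 ≤ (2 * c + 1) * n := by nlinarith
    calc 2 * ((c * (n + 1) + 1) ^ D * l) ≤ 2 * (((2 * c + 1) * n) ^ D * l) := by gcongr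
      _ = _ := by rw [mul_pow]; ring
  have h4 := h2.trans h3
  rw [Real.norm_of_nonneg (by positivity), Real.norm_of_nonneg (by positivity)]
  exact_mod_cast h4

end Growth

/-! ### Symbolic powers and dimension -/

section SymbolicPower

variable {R : Type*} [CommRing R]

theorem pow_le_symbolicPower (I : Ideal R) (n : ℕ) : I ^ n ≤ symbolicPower I n :=
  le_iInf fun _ => Ideal.le_comap_map

theorem symbolicPower_le_radical (I : Ideal R) {n : ℕ} (hn : n ≠ 0) :
    symbolicPower I n ≤ I.radical := by
  rw [← Ideal.sInf_minimalPrimes]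
  refine le_sInf fun p hp => ?_
  have hprime : p.IsPrime := hp.1.1
  refine (iInf_le _ (⟨p, hp⟩ : {p : Ideal R // p ∈ I.minimalPrimes})).trans ?_
  refine (Ideal.comap_mono (Ideal.map_mono ((Ideal.pow_le_self hn).trans hp.1.2))).trans ?_
  rw [Localization.AtPrime.map_eq_maximalIdeal]
  exact (Localization.AtPrime.under_maximalIdeal (I := p)).le

theorem ringKrullDim_quotient_le_symbolicPower (I : Ideal R) {n : ℕ} (hn : n ≠ 0) :
    ringKrullDim (R ⧸ I) ≤ ringKrullDim (R ⧸ symbolicPower I n) := by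
  refine le_trans (le_of_eq ?_)
    (ringKrullDim_quotient_mono (symbolicPower_le_radical I hn))
  rw [ringKrullDim_quotient, ringKrullDim_quotient, PrimeSpectrum.zeroLocus_radical]

theorem le_ringKrullDim_of_le_depth [IsLocalRing R] [IsNoetherianRing R] {k : ℕ}
    (h : (k : ℕ∞) ≤ depth R R) : (k : WithBot ℕ∞) ≤ ringKrullDim R := by
  obtain ⟨rs, rfl, hm, hr⟩ := hasDepth_of_le_depth h
  have hreg := IsRegular.of_isWeaklyRegular_of_mem_maximalIdeal R hm hr
  have hne : Nontrivial (R ⧸ Ideal.ofList rs) := Ideal.Quotient.nontrivial_iff.mpr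
    (ne_top_of_le_ne_top (maximalIdeal.isMaximal R).ne_top (Ideal.span_le.mpr hm))
  rw [← ringKrullDim_add_length_eq_ringKrullDim_of_isRegular rs hreg]
  exact le_add_of_nonneg_left ringKrullDim_nonneg_of_nontrivial

end SymbolicPower

end SymbolicSpread

theorem corollary3p11 {R : Type*} [CommRing R] [IsNoetherianRing R] [IsLocalRing R]
    (I : Ideal R) (d r : ℕ) (hd : ringKrullDim R = d) (hr : ringKrullDim (R ⧸ I) = r) :
    ((r : ℕ∞) ≤ SymbolicSpread.depth R R →
      (∀ᶠ n : ℕ in Filter.atTop,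
        (r : ℕ∞) ≤ SymbolicSpread.depth R (R ⧸ SymbolicSpread.symbolicPower I n) + 1) →
      SymbolicSpread.symbolicAnalyticSpread I ≤ (((d : ℝ) - r + 1 : ℝ) : EReal) ∧
        (d : ℝ) - r + 1 ∈ SymbolicSpread.growthExponents (SymbolicSpread.symbolicPower I)) ∧
    ((r : ℕ∞) + 1 ≤ SymbolicSpread.depth R R →
      (∀ᶠ n : ℕ in Filter.atTop,
        SymbolicSpread.IsCohenMacaulay R (R ⧸ SymbolicSpread.symbolicPower I n)) →
      SymbolicSpread.symbolicAnalyticSpread I ≤ (((d : ℝ) - r : ℝ) : EReal) ∧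
        (d : ℝ) - r ∈ SymbolicSpread.growthExponents (SymbolicSpread.symbolicPower I)) := by
  open SymbolicSpread in
  refine ⟨fun h1 h2 => ?_, fun h1 h2 => ?_⟩
  -- Depth is at most dimension, so the natural subtraction d - r does not truncate.
  · have hrd : r ≤ d := by
      have := le_ringKrullDim_of_le_depth h1
      rw [hd] at this
      exact_mod_cast this
    refine mem_growthExponents_of_isBigO (D := d - r) (by push_cast [hrd]; ring)
      (isBigO_spanFinrank I _ (pow_le_symbolicPower I) r (d - r) hr.le ?_ ?_)
    · rw [hd, Nat.add_sub_cancel' hrd]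
    · filter_upwards [h2] with n hn
      refine hasDepth_of_le_depth ?_
      push_cast
      exact tsub_le_iff_right.mpr hn
  · have hrd : r + 1 ≤ d := by
      have := le_ringKrullDim_of_le_depth (k := r + 1) (by exact_mod_cast h1)
      rw [hd] at this
      exact_mod_cast this
    -- Here s = r + 1 exceeds dim R/I, which is harmless: only dim R/I ≤ s is required.
    refine mem_growthExponents_of_isBigO (D := d - (r + 1)) (by push_cast [hrd]; ring)
      (isBigO_spanFinrank I _ (pow_le_symbolicPower I) (r + 1) (d - (r + 1)) ?_ ?_ ?_)
    · rw [hr]; exact_mod_cast Nat.le_succ r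
    · rw [hd, Nat.add_sub_cancel' hrd]
    -- For n ≠ 0 the dimension of R/I^(n) is at least r. This excludes the zero module allowed by
    -- `IsCohenMacaulay` and gives depth at least r = s - 1.
    · filter_upwards [h2, Filter.eventually_ne_atTop 0] with n hn hn0
      have hdim := ringKrullDim_quotient_le_symbolicPower I hn0
      rw [hr, ← Module.supportDim_quotient_eq_ringKrullDim] at hdim
      refine hasDepth_of_le_depth ?_
      rw [Nat.add_sub_cancel]
      rcases hn with hn | hn
      · rw [Module.supportDim_eq_bot_of_subsingleton] at hdim
        exact absurd hdim (by simp)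
      · rw [← hn] at hdim
        exact_mod_cast hdim
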